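/- Let $M$ be an integer $d\times d$ matrix all of whose eigenvalues are greater than $1$ in absolute value, let $m=|\det M|$, and let $M^*$ be its transpose. Let $D\subset\mathbb Z^d$ be a set of digits for $M$, that is, a set of $m$ vectors that contains $\mathbf 0$ and whose elements are pairwise incongruent modulo $M\mathbb Z^d$; let $D^*$ be a set of digits for $M^*$. Let $V$ be the generalized Vilenkin group associated with $M$ and $D$: the group of sequences $x=(x_j)_{j\in\mathbb Z}$ with $x_j\in D$ and $x_j\ne\mathbf 0$ for only finitely many negative $j$, with coordinate-wise addition modulo $M$, denoted by $\oplus$, and with the group topology in which the sets $U_l=\{x\in V: x_j=\mathbf 0 \text{ for all } j\le l\}$, $l\in\mathbb Z$, form a neighbourhood basis of the neutral element. Let $\mu$ be the Haar measure on $V$ with $\mu(U_0)=1$, and let $H=\{x\in V: x_j=\mathbf 0\text{ for all } j>0\}$. Let $V^*$, $\mu^*$, $H^*$ be the same objects for $M^*$ and $D^*$. For $x\in V$, $\omega\in V^*$ put $$\chi(x,\omega)=\exp\Big(2\pi i\sum_{j\in\mathbb Z}\langle M^{-1}x_j,\omega_{1-j}\rangle\Big),$$ a sum with finitely many nonzero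 terms. The Fourier transform of $f\in L_1(V)$ is $\widehat f(\omega)=\int_V f(x)\overline{\chi(x,\omega)}\,d\mu(x)$, $\omega\in V^*$, and $\varphi\mapsto\widehat\varphi$ on $L_2(V)$ denotes its extension by continuity from $L_1(V)\cap L_2(V)$ to a map $L_2(V)\to L_2(V^*)$. Let $\varphi\in L_2(V)$. The family $(\varphi(\cdot\oplus h))_{h\in H}$, indexed by $h \in H$, is orthonormal in $L_2(V)$ if and only if $$\sum_{h^*\in H^*}|\widehat\varphi(\omega\oplus h^*)|^2=1\quad\text{for $\mu^*$-almost every }\omega\in V^*.$$ -/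

import Mathlib

open MeasureTheory Filter Topology

noncomputable section

namespace GenVilenkin

/-- A dilation matrix: an integer matrix all of whose (complex) eigenvalues have absolute value
greater than `1`. -/
def IsDilationMatrix {d : ℕ} (M : Matrix (Fin d) (Fin d) ℤ) : Prop :=
  ∀ z : ℂ, Module.End.HasEigenvalue (Matrix.toLin' (M.map (Int.cast : ℤ → ℂ))) z → 1 < ‖z‖

/-- Congruence of integer vectors modulo `M`: `l - k = M s` for some integer vector `s`. -/
def Congr {d : ℕ} (M : Matrix (Fin d) (Fin d) ℤ) (l k : Fin d → ℤ) : Prop :=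
  ∃ s : Fin d → ℤ, l - k = M.mulVec s

/-- A set of digits for `M`: it has `|det M|` elements, contains `0`, and its elements are pairwise
incongruent modulo `M`. -/
structure DigitSet {d : ℕ} (M : Matrix (Fin d) (Fin d) ℤ) where
  carrier : Finset (Fin d → ℤ)
  zero_mem : (0 : Fin d → ℤ) ∈ carrier
  card_eq : carrier.card = M.det.natAbs
  incongruent : ∀ a ∈ carrier, ∀ b ∈ carrier, Congr M a b → a = b

variable {d : ℕ} {M : Matrix (Fin d) (Fin d) ℤ}

/-- The digits, as a type. -/
def Digit (D : DigitSet M) : Type := {a : Fin d → ℤ // a ∈ D.carrier}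

/-- The integer vector underlying a digit. -/
def Digit.vec {D : DigitSet M} (a : Digit D) : Fin d → ℤ := a.1

/-- The sublattice `M ℤ^d` of `ℤ^d`. -/
abbrev sublattice (M : Matrix (Fin d) (Fin d) ℤ) : Submodule ℤ (Fin d → ℤ) :=
  LinearMap.range M.mulVecLin

theorem DigitSet.det_ne_zero (D : DigitSet M) : M.det ≠ 0 := by
  intro h
  have h1 := D.card_eq
  rw [h, Int.natAbs_zero, Finset.card_eq_zero] at h1
  have h2 := D.zero_mem
  simp [h1] at h2

theorem card_quotient_sublattice (hM : M.det ≠ 0) :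
    Nat.card ((Fin d → ℤ) ⧸ sublattice M) = M.det.natAbs := by
  have hinj : Function.Injective M.mulVecLin := by
    intro x y hxy
    exact Matrix.mulVec_injective_of_det_ne_zero hM hxy
  rw [← Submodule.natAbs_det_equiv (sublattice M) (LinearEquiv.ofInjective M.mulVecLin hinj),
    ← LinearMap.det_toLin' M]
  congr 2

theorem digit_bijective (D : DigitSet M) :
    Function.Bijective (fun a : Digit D => (sublattice M).mkQ a.vec) := by
  have hc := card_quotient_sublattice D.det_ne_zero
  have hpos : 0 < Nat.card ((Fin d → ℤ) ⧸ sublattice M) := by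
    rw [hc]; exact Int.natAbs_pos.mpr D.det_ne_zero
  have : Finite ((Fin d → ℤ) ⧸ sublattice M) := Nat.finite_of_card_ne_zero hpos.ne'
  have hD : Nat.card (Digit D) = M.det.natAbs := by
    rw [← D.card_eq]
    exact Nat.card_eq_card_toFinset (D.carrier : Set (Fin d → ℤ)) |>.trans (by simp)
  have hinj : Function.Injective (fun a : Digit D => (sublattice M).mkQ a.vec) := by
    intro a b hab
    have h1 : a.vec - b.vec ∈ sublattice M := (Submodule.Quotient.eq _).mp hab
    obtain ⟨s, hs⟩ := h1
    exact Subtype.ext (D.incongruent _ a.2 _ b.2 ⟨s, hs.symm⟩)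
  exact hinj.bijective_of_nat_card_le (by rw [hc, hD])

/-- Each residue class modulo `M` contains exactly one digit. -/
def digitEquiv (D : DigitSet M) : Digit D ≃ ((Fin d → ℤ) ⧸ sublattice M) :=
  Equiv.ofBijective _ (digit_bijective D)

/-- Addition of digits modulo `M`: `a ⊕ b` is the unique digit congruent to `a + b`. -/
instance instAddCommGroupDigit (D : DigitSet M) : AddCommGroup (Digit D) :=
  (digitEquiv D).addCommGroup

theorem Digit.vec_zero (D : DigitSet M) : (0 : Digit D).vec = 0 := by
  have : (0 : Digit D) = ⟨0, D.zero_mem⟩ := by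
    apply (digitEquiv D).injective
    rw [(digitEquiv D).zero_def, Equiv.apply_symm_apply]
    exact ((sublattice M).mkQ.map_zero).symm
  rw [this]; rfl

theorem Digit.vec_add {D : DigitSet M} (a b : Digit D) :
    Congr M (a + b).vec (a.vec + b.vec) := by
  have h : digitEquiv D (a + b) = digitEquiv D a + digitEquiv D b := by
    rw [(digitEquiv D).add_def, Equiv.apply_symm_apply]
  have h1 : (sublattice M).mkQ (a + b).vec = (sublattice M).mkQ (a.vec + b.vec) := by
    rw [map_add]; exact h
  obtain ⟨s, hs⟩ := (Submodule.Quotient.eq _).mp h1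
  exact ⟨s, hs.symm⟩

instance instFiniteDigit (D : DigitSet M) : Finite (Digit D) :=
  inferInstanceAs (Finite {a : Fin d → ℤ // a ∈ D.carrier})

/-- The two-sided digit sequences with finitely many nonzero terms of negative index, under
coordinate-wise addition modulo `M`. -/
def seqSubgroup (D : DigitSet M) : AddSubgroup (ℤ → Digit D) where
  carrier := {x | {j : ℤ | j < 0 ∧ x j ≠ 0}.Finite}
  zero_mem' := by simp
  add_mem' := by
    intro x y hx hy
    refine (hx.union hy).subset ?_
    rintro j ⟨hj, h⟩
    by_contra hc
    simp only [Set.mem_union, Set.mem_ofPred_eq, not_or, not_and, not_not] at hc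
    exact h (by rw [Pi.add_apply, hc.1 hj, hc.2 hj, add_zero])
  neg_mem' := by
    intro x hx
    simpa using hx

/-- The generalized Vilenkin group of a matrix `M` and a set `D` of its digits. -/
def Vilenkin (D : DigitSet M) : Type := seqSubgroup D

instance instAddCommGroupVilenkin (D : DigitSet M) : AddCommGroup (Vilenkin D) :=
  inferInstanceAs (AddCommGroup (seqSubgroup D))

/-- The `j`-th digit of an element. -/
def Vilenkin.coord {D : DigitSet M} (x : Vilenkin D) (j : ℤ) : Digit D := x.1 j

theorem Vilenkin.coord_ext {D : DigitSet M} {x y : Vilenkin D} (h : ∀ j, x.coord j = y.coord j) :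
    x = y := Subtype.ext (funext h)

theorem Vilenkin.coord_zero (D : DigitSet M) (j : ℤ) : (0 : Vilenkin D).coord j = 0 := rfl

theorem Vilenkin.coord_add {D : DigitSet M} (x y : Vilenkin D) (j : ℤ) :
    (x + y).coord j = x.coord j + y.coord j := rfl

theorem Vilenkin.coord_neg {D : DigitSet M} (x : Vilenkin D) (j : ℤ) :
    (-x).coord j = -x.coord j := rfl

/-- The basic neighbourhood `U_l` of the neutral element: `x_j = 0` for all `j ≤ l`. -/
def nbhd (D : DigitSet M) (l : ℤ) : AddSubgroup (Vilenkin D) where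
  carrier := {x | ∀ j ≤ l, x.coord j = 0}
  zero_mem' := fun _ _ => rfl
  add_mem' := by
    intro x y hx hy j hj
    rw [Vilenkin.coord_add, hx j hj, hy j hj, add_zero]
  neg_mem' := by
    intro x hx j hj
    rw [Vilenkin.coord_neg, hx j hj, neg_zero]

/-- The subgroup `H`: `x_j = 0` for all `j > 0`. -/
def subgroupH (D : DigitSet M) : AddSubgroup (Vilenkin D) where
  carrier := {x | ∀ j > 0, x.coord j = 0}
  zero_mem' := fun _ _ => rfl
  add_mem' := by
    intro x y hx hy j hj
    rw [Vilenkin.coord_add, hx j hj, hy j hj, add_zero]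
  neg_mem' := by
    intro x hx j hj
    rw [Vilenkin.coord_neg, hx j hj, neg_zero]

/-- The sets `U_l`, `l ∈ ℤ`, as a basis of neighbourhoods of the neutral element. -/
abbrev nbhdBasis (D : DigitSet M) : AddGroupFilterBasis (Vilenkin D) :=
  addGroupFilterBasisOfComm (Set.range fun l : ℤ => (nbhd D l : Set (Vilenkin D)))
    (Set.range_nonempty _)
    (by
      rintro _ _ ⟨l, rfl⟩ ⟨k, rfl⟩
      exact ⟨_, ⟨max l k, rfl⟩, fun x hx =>
        ⟨fun j hj => hx j (hj.trans (le_max_left _ _)),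
          fun j hj => hx j (hj.trans (le_max_right _ _))⟩⟩)
    (by rintro _ ⟨l, rfl⟩; exact (nbhd D l).zero_mem)
    (by
      rintro _ ⟨l, rfl⟩
      refine ⟨_, ⟨l, rfl⟩, ?_⟩
      rintro _ ⟨x, hx, y, hy, rfl⟩
      exact (nbhd D l).add_mem hx hy)
    (by rintro _ ⟨l, rfl⟩; exact ⟨_, ⟨l, rfl⟩, fun x hx => (nbhd D l).neg_mem hx⟩)

/-- The group topology in which the `U_l` form a neighbourhood basis of the neutral element. -/
instance instTopologicalSpaceVilenkin (D : DigitSet M) : TopologicalSpace (Vilenkin D) :=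
  (nbhdBasis D).topology

instance instIsTopologicalAddGroupVilenkin (D : DigitSet M) :
    IsTopologicalAddGroup (Vilenkin D) :=
  (nbhdBasis D).isTopologicalAddGroup

theorem nbhd_mem_nhds_zero (D : DigitSet M) (l : ℤ) :
    (nbhd D l : Set (Vilenkin D)) ∈ 𝓝 (0 : Vilenkin D) :=
  (nbhdBasis D).mem_nhds_zero ⟨l, rfl⟩

theorem isCompact_nbhd_zero (D : DigitSet M) : IsCompact (nbhd D 0 : Set (Vilenkin D)) := by
  let _ : TopologicalSpace (Digit D) := ⊥
  have : DiscreteTopology (Digit D) := ⟨rfl⟩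
  let g : (ℤ → Digit D) → Vilenkin D := fun y =>
    ⟨fun j => if j ≤ 0 then 0 else y j, by
      refine Set.Finite.subset Set.finite_empty ?_
      rintro j ⟨hj, h⟩
      exact h (if_pos hj.le)⟩
  have hg : ∀ y j, (g y).coord j = if j ≤ 0 then 0 else y j := fun _ _ => rfl
  have hcont : Continuous g := by
    rw [continuous_iff_continuousAt]
    intro y
    refine ((nbhdBasis D).nhds_hasBasis (g y)).tendsto_right_iff.mpr ?_
    rintro _ ⟨l, rfl⟩
    have hev : ∀ᶠ z in 𝓝 y, ∀ j ∈ Set.Icc (0 : ℤ) l, z j = y j := by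
      rw [eventually_all_finite (Set.finite_Icc _ _)]
      intro j _
      exact (continuous_apply j).continuousAt.eventually
        ((isOpen_discrete {y j}).mem_nhds rfl)
    filter_upwards [hev] with z hz
    refine ⟨g z - g y, ?_, by simp⟩
    intro j hj
    rw [sub_eq_add_neg, Vilenkin.coord_add, Vilenkin.coord_neg, hg, hg]
    by_cases h0 : j ≤ 0
    · simp [h0]
    · rw [if_neg h0, if_neg h0, hz j ⟨(not_le.mp h0).le, hj⟩, add_neg_cancel]
  have hrange : Set.range g = (nbhd D 0 : Set (Vilenkin D)) := by
    ext x
    constructor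
    · rintro ⟨y, rfl⟩ j hj
      rw [hg, if_pos hj]
    · intro hx
      refine ⟨x.1, Vilenkin.coord_ext fun j => ?_⟩
      rw [hg]
      split_ifs with h
      · exact (hx j h).symm
      · rfl
  rw [← hrange]
  exact isCompact_range hcont

instance instMeasurableSpaceVilenkin (D : DigitSet M) : MeasurableSpace (Vilenkin D) :=
  borel (Vilenkin D)

instance instBorelSpaceVilenkin (D : DigitSet M) : BorelSpace (Vilenkin D) := ⟨rfl⟩

/-- The set `U = U_0`, compact and with nonempty interior. -/
def unitCompact (D : DigitSet M) : TopologicalSpace.PositiveCompacts (Vilenkin D) where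
  carrier := nbhd D 0
  isCompact' := isCompact_nbhd_zero D
  interior_nonempty' := ⟨0, mem_interior_iff_mem_nhds.mpr (nbhd_mem_nhds_zero D 0)⟩

/-- The Haar measure `μ`, normalized by `μ U = 1`. -/
def haar (D : DigitSet M) : Measure (Vilenkin D) := Measure.addHaarMeasure (unitCompact D)

instance instIsAddHaarMeasureHaar (D : DigitSet M) : (haar D).IsAddHaarMeasure :=
  inferInstanceAs (Measure.addHaarMeasure (unitCompact D)).IsAddHaarMeasure

/-- The space `L₂` of the group. -/
abbrev L2 (D : DigitSet M) : Type := Lp ℂ 2 (haar D)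

/-- The shift `φ ↦ φ(· ⊕ h)` on `L₂`. -/
def shift {D : DigitSet M} (h : Vilenkin D) (φ : L2 D) : L2 D :=
  Lp.compMeasurePreserving (fun x => x + h) (measurePreserving_add_right (haar D) h) φ

/-- The number `⟨M⁻¹ a, b⟩` for digits `a` of `M` and `b` of the transpose of `M`. -/
def digitPairing {D : DigitSet M} {D' : DigitSet M.transpose} (a : Digit D) (b : Digit D') : ℝ :=
  ((M.map (Int.cast : ℤ → ℝ))⁻¹).mulVec (fun i => (a.vec i : ℝ)) ⬝ᵥ (fun i => (b.vec i : ℝ))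

theorem finite_support_digitPairing {D : DigitSet M} {D' : DigitSet M.transpose}
    (x : Vilenkin D) (ω : Vilenkin D') :
    (Function.support fun j : ℤ => digitPairing (x.coord j) (ω.coord (1 - j))).Finite := by
  have hω : ((fun j : ℤ => 1 - j) ⁻¹' {j : ℤ | j < 0 ∧ ω.1 j ≠ 0}).Finite :=
    Set.Finite.preimage (fun a _ b _ h => by simpa using h) ω.2
  have hx : {j : ℤ | j < 0 ∧ x.1 j ≠ 0}.Finite := x.2
  refine ((hx.union hω).union (Set.finite_Icc (0 : ℤ) 1)).subset ?_
  intro j hj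
  have h1 : x.1 j ≠ 0 := by
    intro h
    apply hj
    have : (x.coord j).vec = 0 := by rw [← Digit.vec_zero D]; exact congrArg Digit.vec h
    simp [digitPairing, this, ← Pi.zero_def]
  have h2 : ω.1 (1 - j) ≠ 0 := by
    intro h
    apply hj
    have : (ω.coord (1 - j)).vec = 0 := by rw [← Digit.vec_zero D']; exact congrArg Digit.vec h
    simp [digitPairing, this, ← Pi.zero_def]
  by_cases h0 : j < 0
  · exact Or.inl (Or.inl ⟨h0, h1⟩)
  · by_cases h3 : 1 - j < 0
    · exact Or.inl (Or.inr ⟨h3, h2⟩)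
    · exact Or.inr ⟨not_lt.mp h0, by omega⟩

/-- `χ(x, ω) = exp (2πi ∑_j ⟨M⁻¹ x_j, ω_{1-j}⟩)`; the sum has finitely many nonzero terms. -/
def chi {D : DigitSet M} {D' : DigitSet M.transpose} (x : Vilenkin D) (ω : Vilenkin D') : ℂ :=
  Complex.exp (2 * Real.pi * Complex.I *
    ((∑ᶠ j : ℤ, digitPairing (x.coord j) (ω.coord (1 - j)) : ℝ) : ℂ))

/-- The Fourier transform of an integrable function. -/
def fourierL1 {D : DigitSet M} (D' : DigitSet M.transpose) (f : Vilenkin D → ℂ)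
    (ω : Vilenkin D') : ℂ :=
  ∫ x, f x * (starRingEnd ℂ) (chi x ω) ∂(haar D)

open Classical in
/-- The Fourier transform on `L₁ ∩ L₂`, with values in `L₂` of the dual group (it is always
square-integrable there; the `else` branch only makes the definition total). -/
def fourierL1L2 {D : DigitSet M} (D' : DigitSet M.transpose)
    (f : {f : L2 D // Integrable f (haar D)}) : L2 D' :=
  if h : MemLp (fourierL1 D' (f.1 : Vilenkin D → ℂ)) 2 (haar D') then h.toLp _ else 0

/-- The Fourier transform on `L₂`: the extension by continuity from the dense subspace
`L₁ ∩ L₂`. -/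
def fourierL2 {D : DigitSet M} (D' : DigitSet M.transpose) (φ : L2 D) : L2 D' :=
  limUnder (comap Subtype.val (𝓝 φ)) (fourierL1L2 D')

end GenVilenkin

end

/-!
On the compact open subgroups `U*_{-l}`, which exhaust `V*`, the character `χ(x, ·)` integrates to
the normalised indicator of `x ∈ U_l`. Hence `∫_{U*_{-l}} |f̂|²` is the average over `t ∈ U_l` of
`⟪f, f(· ⊕ t)⟫`, which tends to `‖f‖²`: this is Plancherel's identity, and `f ↦ f̂` extends to an
isometry of `L₂(V)` into `L₂(V*)` that turns the shift by `h` into multiplication by `χ(h, ·)`.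
Orthonormality of the shifts of `φ` therefore says that `∫ χ(h, ·) |φ̂|² dμ*` equals `1` for `h = 0`
and `0` for the other `h ∈ H`. Each `χ(h, ·)` is `H*`-periodic and `U*_0` is a fundamental domain
for `H*`, so these are the integrals of `χ(h, ·)` over `U*_0` against the periodization of `|φ̂|²`.
The density `1` has the same integrals, and a finite measure on `U*_0` is determined by them.
-/

noncomputable section

namespace GenVilenkin

variable {d : ℕ} {M : Matrix (Fin d) (Fin d) ℤ}

open scoped FourierTransform ComplexConjugate ENNReal

section LatticePairing

/-- The pairing `⟨M⁻¹ u, v⟩` of integer vectors, of which `digitPairing` is the case of digits. -/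
def pairing (M : Matrix (Fin d) (Fin d) ℤ) (u v : Fin d → ℤ) : ℝ :=
  (M.map (Int.cast : ℤ → ℝ))⁻¹.mulVec (fun i => (u i : ℝ)) ⬝ᵥ fun i => (v i : ℝ)

theorem pairing_transpose (u v : Fin d → ℤ) : pairing M.transpose v u = pairing M u v := by
  rw [pairing, pairing, Matrix.transpose_map, ← Matrix.transpose_nonsing_inv,
    Matrix.mulVec_transpose, ← Matrix.dotProduct_mulVec, dotProduct_comm]

theorem pairing_add_left (u u' v : Fin d → ℤ) :
    pairing M (u + u') v = pairing M u v + pairing M u' v := by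
  simp only [pairing, Pi.add_apply, Int.cast_add]
  exact (congrArg (· ⬝ᵥ _) (Matrix.mulVec_add _ _ _)).trans (add_dotProduct _ _ _)

theorem isUnit_det_map_intCast (hM : M.det ≠ 0) : IsUnit (M.map (Int.cast : ℤ → ℝ)).det := by
  rw [← Int.cast_det]
  exact (Int.cast_ne_zero.mpr hM).isUnit

theorem intCast_mulVec (s : Fin d → ℤ) :
    (fun i => (M.mulVec s i : ℝ)) = (M.map (Int.cast : ℤ → ℝ)).mulVec fun i => (s i : ℝ) :=
  funext fun i => (Int.castRingHom ℝ).map_mulVec M s i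

theorem pairing_mulVec_left (hM : M.det ≠ 0) (s v : Fin d → ℤ) :
    pairing M (M.mulVec s) v = (s ⬝ᵥ v : ℤ) := by
  rw [pairing, intCast_mulVec, Matrix.mulVec_mulVec,
    Matrix.nonsing_inv_mul _ (isUnit_det_map_intCast hM), Matrix.one_mulVec]
  simp only [dotProduct, Int.cast_sum, Int.cast_mul]

theorem pairing_single_right (u : Fin d → ℤ) (i : Fin d) :
    pairing M u (Pi.single i 1) =
      (M.map (Int.cast : ℤ → ℝ))⁻¹.mulVec (fun i => (u i : ℝ)) i := by
  have h : (fun j => ((Pi.single i 1 : Fin d → ℤ) j : ℝ)) = Pi.single i 1 := by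
    ext j
    simp [Pi.single_apply]
  rw [pairing, h, dotProduct_single_one]

/-- The character `exp (2πi ⟨M⁻¹ u, v⟩)` of integer vectors, which depends only on the classes of
`u` modulo `M` and of `v` modulo the transpose of `M`. -/
def vecChar (M : Matrix (Fin d) (Fin d) ℤ) (u v : Fin d → ℤ) : Circle := 𝐞 (pairing M u v)

theorem vecChar_transpose (u v : Fin d → ℤ) : vecChar M.transpose v u = vecChar M u v := by
  rw [vecChar, vecChar, pairing_transpose]

theorem vecChar_add_left (u u' v : Fin d → ℤ) :
    vecChar M (u + u') v = vecChar M u v * vecChar M u' v := by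
  rw [vecChar, pairing_add_left, AddChar.map_add_eq_mul]
  rfl

theorem vecChar_eq_one_iff (u v : Fin d → ℤ) :
    vecChar M u v = 1 ↔ ∃ n : ℤ, pairing M u v = n := by
  rw [vecChar, Real.fourierChar_apply', Circle.exp_eq_one]
  refine exists_congr fun n => ?_
  rw [mul_comm, mul_left_inj' Real.two_pi_pos.ne']

theorem vecChar_congr_left (hM : M.det ≠ 0) {u u' : Fin d → ℤ} (h : Congr M u u')
    (v : Fin d → ℤ) : vecChar M u v = vecChar M u' v := by
  obtain ⟨s, hs⟩ := h
  have hs1 : vecChar M (M.mulVec s) v = 1 :=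
    (vecChar_eq_one_iff _ _).mpr ⟨_, pairing_mulVec_left hM s v⟩
  rw [sub_eq_iff_eq_add.mp hs, vecChar_add_left, hs1, one_mul]

theorem vecChar_congr_right (hM : M.det ≠ 0) (u : Fin d → ℤ) {v v' : Fin d → ℤ}
    (h : Congr M.transpose v v') : vecChar M u v = vecChar M u v' := by
  rw [← vecChar_transpose u, ← vecChar_transpose u,
    vecChar_congr_left (by rwa [Matrix.det_transpose]) h]

theorem congr_zero_of_vecChar_eq_one (hM : M.det ≠ 0) {u : Fin d → ℤ}
    (h : ∀ v, vecChar M u v = 1) : Congr M u 0 := by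
  have hint (i : Fin d) :
      ∃ n : ℤ, (M.map (Int.cast : ℤ → ℝ))⁻¹.mulVec (fun i => (u i : ℝ)) i = n := by
    rw [← pairing_single_right]
    exact (vecChar_eq_one_iff _ _).mp (h _)
  choose s hs using hint
  have hcast : (fun i => (u i : ℝ)) = fun i => (M.mulVec s i : ℝ) := by
    rw [intCast_mulVec, ← funext hs, Matrix.mulVec_mulVec,
      Matrix.mul_nonsing_inv _ (isUnit_det_map_intCast hM), Matrix.one_mulVec]
  refine ⟨s, ?_⟩
  rw [sub_zero]
  exact funext fun i => Int.cast_injective (congrFun hcast i)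

end LatticePairing

variable {D : DigitSet M} {D' : DigitSet M.transpose}

section DigitPairing

theorem Digit.ext_congr {a b : Digit D} (h : Congr M a.vec b.vec) : a = b :=
  Subtype.ext (D.incongruent _ a.2 _ b.2 h)

theorem Digit.exists_congr (D : DigitSet M) (u : Fin d → ℤ) : ∃ a : Digit D, Congr M u a.vec := by
  obtain ⟨a, ha⟩ := (digit_bijective D).2 ((sublattice M).mkQ u)
  obtain ⟨s, hs⟩ := (Submodule.Quotient.eq _).mp ha.symm
  exact ⟨a, s, hs.symm⟩

/-- The character `exp (2πi ⟨M⁻¹ a, b⟩)` of digits; `χ(x, ω)` is the product of its values at the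
pairs `(x_j, ω_{1-j})`. -/
def digitChar (a : Digit D) (b : Digit D') : Circle := vecChar M a.vec b.vec

theorem digitChar_transpose (a : Digit D) (b : Digit D') :
    digitChar (M := M.transpose) (D' := D) b a = digitChar a b :=
  vecChar_transpose _ _

theorem digitChar_add_left (a a' : Digit D) (b : Digit D') :
    digitChar (a + a') b = digitChar a b * digitChar a' b := by
  rw [digitChar, vecChar_congr_left D.det_ne_zero (Digit.vec_add a a'), vecChar_add_left]
  rfl

theorem digitChar_zero_left (b : Digit D') : digitChar (0 : Digit D) b = 1 := by
  rw [← mul_eq_left (a := digitChar 0 b), ← digitChar_add_left, add_zero]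

theorem digitChar_zero_right (a : Digit D) : digitChar a (0 : Digit D') = 1 :=
  (digitChar_transpose a 0).symm.trans (digitChar_zero_left (D' := D) a)

theorem exists_digitChar_ne_one {a : Digit D} (ha : a ≠ 0) :
    ∃ b : Digit D', digitChar a b ≠ 1 := by
  by_contra! h
  refine ha (Digit.ext_congr ?_)
  rw [Digit.vec_zero]
  refine congr_zero_of_vecChar_eq_one D.det_ne_zero fun v => ?_
  obtain ⟨b, hb⟩ := Digit.exists_congr D' v
  rw [vecChar_congr_right D.det_ne_zero _ hb]
  exact h b

end DigitPairing

section Characters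

theorem finite_mulSupport_digitChar (x : Vilenkin D) (ω : Vilenkin D') :
    (Function.mulSupport fun j : ℤ => digitChar (x.coord j) (ω.coord (1 - j))).Finite := by
  refine (finite_support_digitPairing x ω).subset fun j hj h0 => hj ?_
  exact (congrArg 𝐞 h0).trans (AddChar.map_zero_eq_one 𝐞)

theorem chi_eq_finprod (x : Vilenkin D) (ω : Vilenkin D') :
    chi x ω = (∏ᶠ j : ℤ, digitChar (x.coord j) (ω.coord (1 - j)) : Circle) := by
  have hS := finite_support_digitPairing x ω
  have hP := finite_mulSupport_digitChar x ω
  have hexp : ∏ᶠ j : ℤ, digitChar (x.coord j) (ω.coord (1 - j)) =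
      𝐞 (∑ᶠ j : ℤ, digitPairing (x.coord j) (ω.coord (1 - j))) := by
    rw [finsum_eq_sum_of_support_subset (s := (hS.union hP).toFinset) _ (by simp),
      finprod_eq_prod_of_mulSupport_subset (s := (hS.union hP).toFinset) _ (by simp)]
    exact (map_sum 𝐞.toAddMonoidHom _ _).symm
  rw [hexp, chi, Real.fourierChar_apply]
  push_cast
  ring_nf

theorem norm_chi (x : Vilenkin D) (ω : Vilenkin D') : ‖chi x ω‖ = 1 := by
  rw [chi_eq_finprod, Circle.norm_coe]

theorem chi_transpose (x : Vilenkin D) (ω : Vilenkin D') :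
    chi (M := M.transpose) (D' := D) ω x = chi x ω := by
  have hprod : ∏ᶠ j : ℤ, digitChar (M := M.transpose) (D' := D) (ω.coord j) (x.coord (1 - j)) =
      ∏ᶠ j : ℤ, digitChar (x.coord j) (ω.coord (1 - j)) := by
    rw [← finprod_comp_equiv (Equiv.subLeft (1 : ℤ))]
    refine finprod_congr fun j => ?_
    rw [Equiv.subLeft_apply, sub_sub_cancel]
    exact digitChar_transpose _ _
  exact (chi_eq_finprod (M := M.transpose) (D' := D) ω x).trans
    ((congrArg _ hprod).trans (chi_eq_finprod x ω).symm)

theorem chi_add_left (x y : Vilenkin D) (ω : Vilenkin D') :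
    chi (x + y) ω = chi x ω * chi y ω := by
  simp only [chi_eq_finprod, Vilenkin.coord_add, digitChar_add_left]
  rw [finprod_mul_distrib (finite_mulSupport_digitChar x ω) (finite_mulSupport_digitChar y ω),
    Circle.coe_mul]

theorem chi_add_right (x : Vilenkin D) (ω ω' : Vilenkin D') :
    chi x (ω + ω') = chi x ω * chi x ω' :=
  (chi_transpose x _).symm.trans <| (chi_add_left (D' := D) ω ω' x).trans <|
    congrArg₂ _ (chi_transpose x ω) (chi_transpose x ω')

theorem chi_eq_one_of_forall {x : Vilenkin D} {ω : Vilenkin D'}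
    (h : ∀ j, x.coord j = 0 ∨ ω.coord (1 - j) = 0) : chi x ω = 1 := by
  rw [chi_eq_finprod, finprod_eq_one_of_forall_eq_one fun j => ?_, Circle.coe_one]
  rcases h j with h | h
  · rw [h, digitChar_zero_left]
  · rw [h, digitChar_zero_right]

theorem chi_zero_left (ω : Vilenkin D') : chi (0 : Vilenkin D) ω = 1 :=
  chi_eq_one_of_forall fun j => Or.inl (Vilenkin.coord_zero D j)

theorem chi_neg_left (x : Vilenkin D) (ω : Vilenkin D') : chi (-x) ω = conj (chi x ω) := by
  have hne : chi x ω ≠ 0 := Complex.exp_ne_zero _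
  refine mul_left_cancel₀ hne ?_
  rw [← chi_add_left, add_neg_cancel, chi_zero_left, Complex.mul_conj', norm_chi]
  simp only [Complex.ofReal_one, one_pow]

theorem chi_eq_one_of_mem_nbhd {x : Vilenkin D} {ω : Vilenkin D'} {l k : ℤ} (hlk : 0 ≤ l + k)
    (hx : x ∈ nbhd D l) (hω : ω ∈ nbhd D' k) : chi x ω = 1 :=
  chi_eq_one_of_forall fun j => (le_or_gt j l).imp (hx j) fun h => hω _ (by lia)

theorem chi_eq_one_of_mem_subgroupH {x : Vilenkin D} {ω : Vilenkin D'}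
    (hx : x ∈ subgroupH D) (hω : ω ∈ subgroupH D') : chi x ω = 1 :=
  chi_eq_one_of_forall fun j => (lt_or_ge 0 j).imp (hx j) fun h => hω _ (by lia)

/-- The sequence with the digit `a` at the place `j` and zeros elsewhere; pairing with it reads off
a single digit of the other argument of `χ`. -/
def single (j : ℤ) (a : Digit D) : Vilenkin D :=
  ⟨Pi.single j a, (Set.finite_singleton j).subset fun k hk => by
    by_contra h
    exact hk.2 (Pi.single_eq_of_ne (M := fun _ => Digit D) h a)⟩

theorem coord_single_same (j : ℤ) (a : Digit D) : (single j a).coord j = a :=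
  Pi.single_eq_same (M := fun _ => Digit D) j a

theorem coord_single_of_ne {j k : ℤ} (h : k ≠ j) (a : Digit D) : (single j a).coord k = 0 :=
  Pi.single_eq_of_ne (M := fun _ => Digit D) h a

theorem single_mem_nbhd {j l : ℤ} (h : l < j) (a : Digit D) : single j a ∈ nbhd D l :=
  fun _ hk => coord_single_of_ne (hk.trans_lt h).ne a

theorem chi_single_right (x : Vilenkin D) (j : ℤ) (b : Digit D') :
    chi x (single j b) = digitChar (x.coord (1 - j)) b := by
  rw [chi_eq_finprod, finprod_eq_single _ (1 - j), sub_sub_cancel, coord_single_same]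
  intro k hk
  rw [coord_single_of_ne (by lia), digitChar_zero_right]

theorem exists_chi_ne_one_of_notMem_nbhd (D' : DigitSet M.transpose) {x : Vilenkin D} {l : ℤ}
    (hx : x ∉ nbhd D l) : ∃ ω ∈ nbhd D' (-l), chi x ω ≠ 1 := by
  obtain ⟨j, hj, hxj⟩ : ∃ j ≤ l, x.coord j ≠ 0 := by
    by_contra! h
    exact hx h
  obtain ⟨b, hb⟩ := exists_digitChar_ne_one (D' := D') hxj
  refine ⟨single (1 - j) b, single_mem_nbhd (by lia) b, ?_⟩
  rwa [chi_single_right, sub_sub_cancel, ne_eq, Circle.coe_eq_one]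

end Characters

section Cosets

theorem nbhd_antitone (D : DigitSet M) : Antitone (nbhd D) :=
  fun _ _ h _ hx j hj => hx j (hj.trans h)

theorem eventually_mem_nbhd (x : Vilenkin D) : ∀ᶠ l in atBot, x ∈ nbhd D l := by
  have hx : {j : ℤ | j < 0 ∧ x.1 j ≠ 0}.Finite := x.2
  obtain ⟨b, hb⟩ := hx.bddBelow
  filter_upwards [eventually_lt_atBot (min b 0)] with l hl j hj
  by_contra h
  have hbj : b ≤ j := hb ⟨by lia, h⟩
  lia

/-- The coset `a ⊕ U_l`, a basic open set of the topology. -/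
def coset (a : Vilenkin D) (l : ℤ) : Set (Vilenkin D) := {x | x - a ∈ nbhd D l}

theorem mem_coset_self (a : Vilenkin D) (l : ℤ) : a ∈ coset a l := by
  rw [coset, Set.mem_ofPred_eq, sub_self]
  exact zero_mem _

theorem coset_zero (D : DigitSet M) (l : ℤ) : coset (0 : Vilenkin D) l = nbhd D l := by
  simp only [coset, sub_zero, SetLike.setOfPred_mem_eq]

theorem coset_subset_coset (a : Vilenkin D) {k l : ℤ} (h : k ≤ l) : coset a l ⊆ coset a k :=
  fun _ hx => nbhd_antitone D h hx

theorem coset_eq_of_mem {a x : Vilenkin D} {l : ℤ} (hx : x ∈ coset a l) :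
    coset a l = coset x l := by
  ext y
  simp only [coset, Set.mem_ofPred_eq]
  rw [← sub_add_sub_cancel y x a]
  exact AddSubgroup.add_mem_cancel_right _ hx

theorem coset_inter_coset {a b x : Vilenkin D} {k l : ℤ} (ha : x ∈ coset a k)
    (hb : x ∈ coset b l) : coset a k ∩ coset b l = coset x (max k l) := by
  rw [coset_eq_of_mem ha, coset_eq_of_mem hb]
  rcases le_total k l with h | h
  · rw [max_eq_right h, Set.inter_eq_right.mpr (coset_subset_coset x h)]
  · rw [max_eq_left h, Set.inter_eq_left.mpr (coset_subset_coset x h)]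

/-- The truncation of a sequence to the places `j ≤ l`, a representative of its coset modulo `U_l`;
for `l = 0` it lies in `H`. -/
def trunc (l : ℤ) (x : Vilenkin D) : Vilenkin D :=
  ⟨fun j => if j ≤ l then x.coord j else 0, x.2.subset fun _ hj =>
    ⟨hj.1, (ite_ne_right_iff.mp hj.2).2⟩⟩

theorem coord_trunc (l : ℤ) (x : Vilenkin D) (j : ℤ) :
    (trunc l x).coord j = if j ≤ l then x.coord j else 0 := rfl

theorem sub_trunc_mem_nbhd (l : ℤ) (x : Vilenkin D) : x - trunc l x ∈ nbhd D l := by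
  intro j hj
  rw [sub_eq_add_neg, Vilenkin.coord_add, Vilenkin.coord_neg, coord_trunc, if_pos hj,
    add_neg_cancel]

theorem trunc_zero_mem_subgroupH (x : Vilenkin D) : trunc 0 x ∈ subgroupH D :=
  fun _ hj => if_neg hj.not_ge

theorem finite_support_trunc (l : ℤ) (x : Vilenkin D) : (trunc l x).coord.support.Finite := by
  refine ((trunc l x).2.union (Set.finite_Icc 0 l)).subset fun j hj => ?_
  rcases lt_or_ge j 0 with h | h
  · exact Or.inl ⟨h, hj⟩
  · exact Or.inr ⟨h, (ite_ne_right_iff.mp hj).1⟩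

theorem countable_setOf_finite_support (D : DigitSet M) :
    {x : Vilenkin D | x.coord.support.Finite}.Countable := by
  refine Set.countable_coe_iff.mp (Function.Injective.countable
    (f := fun x : {x : Vilenkin D | x.coord.support.Finite} =>
      Finsupp.ofSupportFinite x.1.coord x.2) fun x y hxy => ?_)
  exact Subtype.ext (Vilenkin.coord_ext (DFunLike.congr_fun hxy))

theorem countable_range_coset (D : DigitSet M) :
    (Set.range fun p : Vilenkin D × ℤ => coset p.1 p.2).Countable := by
  refine (((countable_setOf_finite_support D).prod Set.countable_univ).image
    fun p : Vilenkin D × ℤ => coset p.1 p.2).mono ?_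
  rintro _ ⟨⟨x, l⟩, rfl⟩
  refine ⟨(trunc l x, l), ⟨finite_support_trunc l x, trivial⟩, ?_⟩
  exact coset_eq_of_mem (sub_trunc_mem_nbhd l x)

theorem disjoint_subgroupH_nbhd_zero (D : DigitSet M) : Disjoint (subgroupH D) (nbhd D 0) :=
  AddSubgroup.disjoint_def.mpr fun hH hU => Vilenkin.coord_ext fun j =>
    (le_or_gt j 0).elim (hU j) (hH j)

instance instCountableSubgroupH (D : DigitSet M) : Countable (subgroupH D) := by
  refine ((countable_setOf_finite_support D).mono fun x hx => ?_).to_subtype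
  have : trunc 0 x = x := Vilenkin.coord_ext fun j => by
    rw [coord_trunc]
    split_ifs with hj
    · rfl
    · exact (hx j (not_le.mp hj)).symm
  exact this ▸ finite_support_trunc 0 x

end Cosets

section Topology

theorem isOpen_nbhd (D : DigitSet M) (l : ℤ) : IsOpen (nbhd D l : Set (Vilenkin D)) :=
  AddSubgroup.isOpen_of_mem_nhds (nbhd D l) (nbhd_mem_nhds_zero D l)

theorem measurableSet_nbhd (D : DigitSet M) (l : ℤ) :
    MeasurableSet (nbhd D l : Set (Vilenkin D)) := (isOpen_nbhd D l).measurableSet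

theorem isOpen_coset (a : Vilenkin D) (l : ℤ) : IsOpen (coset a l) :=
  (isOpen_nbhd D l).preimage (continuous_sub_right a)

theorem nhds_hasBasis_coset (x : Vilenkin D) :
    (𝓝 x).HasBasis (fun _ : ℤ => True) (coset x) := by
  refine ((nbhdBasis D).nhds_hasBasis x).to_hasBasis ?_ ?_
  · rintro _ ⟨l, rfl⟩
    exact ⟨l, trivial, fun y hy => ⟨y - x, hy, add_sub_cancel _ _⟩⟩
  · intro l _
    refine ⟨_, ⟨l, rfl⟩, ?_⟩
    rintro _ ⟨u, hu, rfl⟩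
    rwa [coset, Set.mem_ofPred_eq, add_sub_cancel_left]

theorem isTopologicalBasis_coset (D : DigitSet M) : TopologicalSpace.IsTopologicalBasis
    (Set.range fun p : Vilenkin D × ℤ => coset p.1 p.2) := by
  refine TopologicalSpace.isTopologicalBasis_of_isOpen_of_nhds ?_ fun x u hx hu => ?_
  · rintro _ ⟨p, rfl⟩
    exact isOpen_coset _ _
  · obtain ⟨l, -, hl⟩ := (nhds_hasBasis_coset x).mem_iff.mp (hu.mem_nhds hx)
    exact ⟨_, ⟨(x, l), rfl⟩, mem_coset_self x l, hl⟩

theorem isPiSystem_range_coset (D : DigitSet M) :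
    IsPiSystem (Set.range fun p : Vilenkin D × ℤ => coset p.1 p.2) := by
  rintro _ ⟨⟨a, k⟩, rfl⟩ _ ⟨⟨b, l⟩, rfl⟩ ⟨x, ha, hb⟩
  exact ⟨(x, max k l), (coset_inter_coset ha hb).symm⟩

instance instSecondCountableTopologyVilenkin (D : DigitSet M) :
    SecondCountableTopology (Vilenkin D) :=
  (isTopologicalBasis_coset D).secondCountableTopology (countable_range_coset D)

instance instLocallyCompactSpaceVilenkin (D : DigitSet M) : LocallyCompactSpace (Vilenkin D) :=
  (isCompact_nbhd_zero D).locallyCompactSpace_of_mem_nhds_of_addGroup (nbhd_mem_nhds_zero D 0)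

theorem chi_eq_of_mem_coset_left {x y : Vilenkin D} {ω : Vilenkin D'} {l k : ℤ}
    (hlk : 0 ≤ l + k) (hy : y ∈ coset x l) (hω : ω ∈ nbhd D' k) : chi y ω = chi x ω := by
  rw [← sub_add_cancel y x, chi_add_left, chi_eq_one_of_mem_nbhd hlk hy hω, one_mul]

theorem chi_eq_of_mem_coset_right {x : Vilenkin D} {ω η : Vilenkin D'} {l k : ℤ}
    (hlk : 0 ≤ l + k) (hx : x ∈ nbhd D l) (hη : η ∈ coset ω k) : chi x η = chi x ω := by
  rw [← sub_add_cancel η ω, chi_add_right, chi_eq_one_of_mem_nbhd hlk hx hη, one_mul]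

theorem continuous_chi : Continuous fun p : Vilenkin D × Vilenkin D' => chi p.1 p.2 := by
  refine continuous_iff_continuousAt.mpr fun ⟨x, ω⟩ => ?_
  obtain ⟨l, ⟨hx, hω⟩, hl⟩ := (((eventually_mem_nbhd x).and (eventually_mem_nbhd ω)).and
    (eventually_le_atBot 0)).exists
  refine (continuousAt_const (y := chi x ω)).congr ?_
  filter_upwards [prod_mem_nhds ((nhds_hasBasis_coset x).mem_of_mem (i := -l) trivial)
    ((nhds_hasBasis_coset ω).mem_of_mem (i := -l) trivial)] with ⟨y, η⟩ ⟨hy, hη⟩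
  have hηl : η ∈ nbhd D' l := by
    rw [← sub_add_cancel η ω]
    exact add_mem (nbhd_antitone D' (by lia) hη) hω
  rw [chi_eq_of_mem_coset_left (by lia) hy hηl, chi_eq_of_mem_coset_right (by lia) hx hη]

theorem continuous_chi_left (ω : Vilenkin D') : Continuous fun x : Vilenkin D => chi x ω :=
  Continuous.comp (f := fun x : Vilenkin D => (x, ω)) (continuous_chi (D := D) (D' := D'))
    (continuous_id.prodMk continuous_const)

theorem continuous_chi_right (x : Vilenkin D) : Continuous fun ω : Vilenkin D' => chi x ω :=
  Continuous.comp (f := fun ω : Vilenkin D' => (x, ω)) (continuous_chi (D := D) (D' := D'))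
    (continuous_const.prodMk continuous_id)

theorem integrable_chi_right (x : Vilenkin D) (ν : Measure (Vilenkin D')) [IsFiniteMeasure ν] :
    Integrable (chi x) ν :=
  Integrable.of_bound (continuous_chi_right x).aestronglyMeasurable 1
    (Eventually.of_forall fun ω => (norm_chi x ω).le)

end Topology

section HaarMeasure

theorem card_digit (D : DigitSet M) : Nat.card (Digit D) = M.det.natAbs := by
  rw [← D.card_eq]
  exact (Nat.card_eq_card_toFinset (D.carrier : Set (Fin d → ℤ))).trans (by simp)

theorem haar_coset (a : Vilenkin D) (l : ℤ) : haar D (coset a l) = haar D (nbhd D l) := by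
  simp only [coset, sub_eq_add_neg]
  exact measure_preimage_add_right _ _ _

theorem nbhd_eq_iUnion_coset (D : DigitSet M) (l : ℤ) :
    (nbhd D l : Set (Vilenkin D)) = ⋃ a : Digit D, coset (single (l + 1) a) (l + 1) := by
  refine Set.Subset.antisymm (fun x hx => Set.mem_iUnion.mpr ⟨x.coord (l + 1), ?_⟩)
    (Set.iUnion_subset fun a x hx => ?_)
  · intro j hj
    rw [sub_eq_add_neg, Vilenkin.coord_add, Vilenkin.coord_neg]
    rcases eq_or_ne j (l + 1) with rfl | h
    · rw [coord_single_same, add_neg_cancel]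
    · rw [coord_single_of_ne h, hx j (by lia), neg_zero, add_zero]
  · rw [← sub_add_cancel x (single (l + 1) a)]
    exact add_mem (nbhd_antitone D (lt_add_one l).le hx) (single_mem_nbhd (lt_add_one l) a)

theorem pairwise_disjoint_coset_single (D : DigitSet M) (l : ℤ) :
    Pairwise (Function.onFun Disjoint fun a : Digit D => coset (single l a) l) := by
  refine fun a b hab => Set.disjoint_left.mpr fun x ha hb => hab ?_
  have h := (nbhd D l).sub_mem hb ha l le_rfl
  rw [sub_sub_sub_cancel_left, sub_eq_add_neg, Vilenkin.coord_add, Vilenkin.coord_neg,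
    coord_single_same, coord_single_same] at h
  exact add_neg_eq_zero.mp h

theorem haar_nbhd_eq_mul (D : DigitSet M) (l : ℤ) :
    haar D (nbhd D l) = M.det.natAbs * haar D (nbhd D (l + 1)) := by
  have := Fintype.ofFinite (Digit D)
  rw [nbhd_eq_iUnion_coset, measure_iUnion (pairwise_disjoint_coset_single D _) fun a =>
    (isOpen_coset _ _).measurableSet]
  simp only [haar_coset, tsum_fintype, Finset.sum_const, Finset.card_univ, nsmul_eq_mul]
  rw [← Nat.card_eq_fintype_card, card_digit]

theorem haar_nbhd (D : DigitSet M) (l : ℤ) :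
    haar D (nbhd D l) = (M.det.natAbs : ℝ≥0∞) ^ (-l) := by
  have hm0 : (M.det.natAbs : ℝ≥0∞) ≠ 0 :=
    Nat.cast_ne_zero.mpr (Int.natAbs_ne_zero.mpr D.det_ne_zero)
  have hm : (M.det.natAbs : ℝ≥0∞) ≠ ⊤ := ENNReal.natCast_ne_top _
  have hstep (k : ℤ) : (M.det.natAbs : ℝ≥0∞) ^ (-k) =
      M.det.natAbs * (M.det.natAbs : ℝ≥0∞) ^ (-(k + 1)) := by
    rw [show -k = 1 + -(k + 1) by ring, ENNReal.zpow_add hm0 hm, zpow_one]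
  induction l with
  | zero =>
    have h : haar D (nbhd D 0) = 1 := Measure.addHaarMeasure_self
    simpa using h
  | succ n ih =>
    rw [haar_nbhd_eq_mul, hstep] at ih
    exact (ENNReal.mul_right_inj hm0 hm).mp ih
  | pred n ih => rw [haar_nbhd_eq_mul, hstep, sub_add_cancel, ih]

theorem haar_nbhd_lt_top (D : DigitSet M) (l : ℤ) : haar D (nbhd D l) < ⊤ := by
  rw [haar_nbhd]
  exact ENNReal.zpow_lt_top (Nat.cast_ne_zero.mpr (Int.natAbs_ne_zero.mpr D.det_ne_zero))
    (ENNReal.natCast_ne_top _) _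

theorem measureReal_nbhd_ne_zero (D : DigitSet M) (l : ℤ) : (haar D).real (nbhd D l) ≠ 0 := by
  refine ENNReal.toReal_ne_zero.mpr ⟨?_, (haar_nbhd_lt_top D l).ne⟩
  exact ((isOpen_nbhd D l).measure_pos _ ⟨0, zero_mem _⟩).ne'

theorem measureReal_nbhd_neg (D : DigitSet M) (D' : DigitSet M.transpose) (l : ℤ) :
    (haar D').real (nbhd D' (-l)) = ((haar D).real (nbhd D l))⁻¹ := by
  rw [Measure.real, Measure.real, haar_nbhd, haar_nbhd, Matrix.det_transpose, ENNReal.zpow_neg,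
    ENNReal.toReal_inv]

instance instIsFiniteMeasureRestrictNbhd (D : DigitSet M) (l : ℤ) :
    IsFiniteMeasure ((haar D).restrict (nbhd D l)) :=
  ⟨by rw [Measure.restrict_apply_univ]; exact haar_nbhd_lt_top D l⟩

end HaarMeasure

section FourierL1

theorem setIntegral_addSubgroup_eq_zero {G : Type*} [AddGroup G] [MeasurableSpace G]
    [MeasurableAdd G] {μ : Measure G} [μ.IsAddLeftInvariant] {K : AddSubgroup G} {η : G}
    {χ : G → ℂ} (hχ : ∀ ω, χ (η + ω) = χ η * χ ω) (hη : η ∈ K) (hη1 : χ η ≠ 1) :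
    ∫ ω in K, χ ω ∂μ = 0 := by
  have hK : (η + ·) ⁻¹' (K : Set G) = K := Set.ext fun ω => AddSubgroup.add_mem_cancel_left _ hη
  have h := (measurePreserving_add_left μ η).setIntegral_preimage_emb
    (measurableEmbedding_addLeft η) χ K
  simp only [hK, hχ, integral_const_mul] at h
  exact by_contra fun h0 => hη1 ((mul_eq_right₀ h0).mp h)

theorem setIntegral_chi (x : Vilenkin D) (l : ℤ) :
    ∫ ω in nbhd D' (-l), chi x ω ∂(haar D') =
      (nbhd D l : Set (Vilenkin D)).indicator
        (fun _ => (((haar D).real (nbhd D l))⁻¹ : ℂ)) x := by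
  by_cases hx : x ∈ nbhd D l
  · rw [Set.indicator_of_mem (SetLike.mem_coe.mpr hx), setIntegral_congr_fun
      (measurableSet_nbhd D' (-l)) fun ω hω => chi_eq_one_of_mem_nbhd (by lia) hx hω,
      setIntegral_const, measureReal_nbhd_neg, Complex.real_smul, mul_one, Complex.ofReal_inv]
  · obtain ⟨η, hη, hη1⟩ := exists_chi_ne_one_of_notMem_nbhd D' hx
    rw [Set.indicator_of_notMem (mt SetLike.mem_coe.mp hx)]
    exact setIntegral_addSubgroup_eq_zero (chi_add_right x η) hη hη1

theorem integrable_mul_conj_chi {f : Vilenkin D → ℂ} (hf : Integrable f (haar D))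
    (ω : Vilenkin D') : Integrable (fun x => f x * conj (chi x ω)) (haar D) := by
  refine hf.mul_bdd (c := 1) ?_ (.of_forall fun x => ?_)
  · exact (Complex.continuous_conj.comp (continuous_chi_left ω)).aestronglyMeasurable
  · rw [RCLike.norm_conj, norm_chi]

theorem continuous_fourierL1 {f : Vilenkin D → ℂ} (hf : Integrable f (haar D)) :
    Continuous (fourierL1 D' f) := by
  refine continuous_of_dominated (bound := fun x => ‖f x‖)
    (fun ω => (integrable_mul_conj_chi hf ω).aestronglyMeasurable) (fun ω => ?_) hf.norm ?_
  · exact .of_forall fun x => by rw [norm_mul, RCLike.norm_conj, norm_chi, mul_one]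
  · exact .of_forall fun x => continuous_const.mul
      (Complex.continuous_conj.comp (continuous_chi_right x))

theorem norm_fourierL1_le (f : Vilenkin D → ℂ) (ω : Vilenkin D') :
    ‖fourierL1 D' f ω‖ ≤ ∫ x, ‖f x‖ ∂(haar D) := by
  refine (norm_integral_le_integral_norm _).trans_eq ?_
  simp only [norm_mul, RCLike.norm_conj, norm_chi, mul_one]

theorem integral_fourierL1_mul {f : Vilenkin D → ℂ} (hf : Integrable f (haar D))
    {ν : Measure (Vilenkin D')} [SFinite ν] {g : Vilenkin D' → ℂ} (hg : Integrable g ν) :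
    ∫ ω, fourierL1 D' f ω * g ω ∂ν =
      ∫ x, f x * ∫ ω, conj (chi x ω) * g ω ∂ν ∂(haar D) := by
  simp only [fourierL1, ← integral_mul_const, ← integral_const_mul, mul_assoc]
  refine integral_integral_swap ?_
  have hc : Continuous fun p : Vilenkin D' × Vilenkin D => conj (chi p.2 p.1) :=
    Complex.continuous_conj.comp (Continuous.comp (f := Prod.swap)
      (continuous_chi (D := D) (D' := D')) continuous_swap)
  refine ((hg.mul_prod hf).mul_bdd (c := 1) hc.aestronglyMeasurable
    (.of_forall fun p => ?_)).congr (.of_forall fun p => ?_)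
  · rw [RCLike.norm_conj, norm_chi]
  · simp only [Function.uncurry]
    ring

theorem setIntegral_chi_mul_fourierL1 {f : Vilenkin D → ℂ} (hf : Integrable f (haar D))
    (x : Vilenkin D) (l : ℤ) :
    ∫ ω in nbhd D' (-l), chi x ω * fourierL1 D' f ω ∂(haar D') =
      ⨍ t in nbhd D l, f (x + t) ∂(haar D) := by
  have hkernel (t : Vilenkin D) :
      ∫ ω in nbhd D' (-l), conj (chi (x + t) ω) * chi x ω ∂(haar D') =
        (nbhd D l : Set (Vilenkin D)).indicator
          (fun _ => (((haar D).real (nbhd D l))⁻¹ : ℂ)) (-t) := by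
    rw [← setIntegral_chi (D' := D')]
    simp only [← chi_neg_left, ← chi_add_left, neg_add_rev, neg_add_cancel_right]
  simp only [mul_comm (chi x _)]
  rw [integral_fourierL1_mul hf (integrable_chi_right x _), ← integral_add_left_eq_self _ x,
    setAverage_eq, ← integral_smul, ← integral_indicator (measurableSet_nbhd D l)]
  refine integral_congr_ae (.of_forall fun t => ?_)
  classical
  simp only [hkernel, Set.indicator_apply, SetLike.mem_coe, neg_mem_iff]
  split_ifs
  · rw [Complex.real_smul, mul_comm, Complex.ofReal_inv]
  · exact mul_zero _

theorem setIntegral_normSq_fourierL1 {f : Vilenkin D → ℂ} (hf : Integrable f (haar D)) (l : ℤ) :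
    ∫ ω in nbhd D' (-l), fourierL1 D' f ω * conj (fourierL1 D' f ω) ∂(haar D') =
      ⨍ t in nbhd D l, ∫ x, f x * conj (f (x + t)) ∂(haar D) ∂(haar D) := by
  have hint : Integrable (fun ω => conj (fourierL1 D' f ω))
      ((haar D').restrict (nbhd D' (-l))) :=
    Integrable.of_bound
      (Complex.continuous_conj.comp (continuous_fourierL1 hf)).aestronglyMeasurable _
      (.of_forall fun ω => by rw [RCLike.norm_conj]; exact norm_fourierL1_le f ω)
  have hprod : Integrable (Function.uncurry fun x t => f x * conj (f (x + t)))
      ((haar D).prod ((haar D).restrict (nbhd D l))) :=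
    ((measurePreserving_prod_add (haar D) (haar D)).integrable_comp_of_integrable
      (hf.mul_prod (Complex.conjLIE.integrable_comp_iff.mpr hf))).mono_measure
      (Measure.prod_mono le_rfl Measure.restrict_le_self)
  rw [integral_fourierL1_mul hf hint, setAverage_eq, ← integral_integral_swap hprod,
    ← integral_smul]
  refine integral_congr_ae (.of_forall fun x => ?_)
  simp only [← map_mul, integral_conj, setIntegral_chi_mul_fourierL1 hf, setAverage_eq,
    integral_const_mul, Complex.real_smul]
  rw [map_mul, Complex.conj_ofReal, mul_left_comm]

end FourierL1

section Plancherel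

theorem shift_coeFn (t : Vilenkin D) (φ : L2 D) : shift t φ =ᵐ[haar D] fun x => φ (x + t) :=
  Lp.coeFn_compMeasurePreserving φ (measurePreserving_add_right (haar D) t)

theorem continuous_shift (φ : L2 D) : Continuous fun t : Vilenkin D => shift t φ := by
  let g : C(Vilenkin D, C(Vilenkin D, Vilenkin D)) :=
    (ContinuousMap.mk (fun p : Vilenkin D × Vilenkin D => p.2 + p.1) (by fun_prop)).curry
  exact (continuous_const (y := φ)).compMeasurePreservingLp g.continuous
    (fun t => measurePreserving_add_right (haar D) t) ENNReal.ofNat_ne_top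

theorem shift_add (h k : Vilenkin D) (φ : L2 D) : shift (h + k) φ = shift h (shift k φ) := by
  refine Lp.ext ?_
  filter_upwards [shift_coeFn h (shift k φ), shift_coeFn (h + k) φ,
    (measurePreserving_add_right (haar D) h).quasiMeasurePreserving.ae (shift_coeFn k φ)]
    with x h1 h2 h3
  rw [h1, h2, h3, add_assoc]

theorem inner_shift_shift (h : Vilenkin D) (φ ψ : L2 D) :
    inner ℂ (shift h φ) (shift h ψ) = inner ℂ φ ψ :=
  LinearIsometry.inner_map_map
    (Lp.compMeasurePreservingₗᵢ ℂ (fun x => x + h) (measurePreserving_add_right (haar D) h)) φ ψ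

theorem tendsto_setAverage_nbhd {E : Type*} [NormedAddCommGroup E] [NormedSpace ℝ E]
    [CompleteSpace E] {F : Vilenkin D → E} (hF : Continuous F) :
    Tendsto (fun l : ℤ => ⨍ t in nbhd D l, F t ∂(haar D)) atTop (𝓝 (F 0)) := by
  have hs : Tendsto (fun l : ℤ => (nbhd D l : Set (Vilenkin D))) atTop (𝓝 0).smallSets := by
    refine tendsto_smallSets_iff.mpr fun t ht => ?_
    obtain ⟨l, -, hl⟩ := (nhds_hasBasis_coset (0 : Vilenkin D)).mem_iff.mp ht
    rw [coset_zero] at hl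
    filter_upwards [eventually_ge_atTop l] with k hk
    exact (SetLike.coe_subset_coe.mpr (nbhd_antitone D hk)).trans hl
  have h := (hF.continuousAt.integral_sub_linear_isLittleO_ae
    (hF.stronglyMeasurable.stronglyMeasurableAtFilter (μ := haar D)) hs).tendsto_inv_smul_nhds_zero
  refine tendsto_sub_nhds_zero_iff.mp (h.congr fun l => ?_)
  rw [smul_sub, inv_smul_smul₀ (measureReal_nbhd_ne_zero D l), setAverage_eq]

theorem integral_mul_conj_eq_inner_shift (t : Vilenkin D) (φ : L2 D) :
    ∫ x, φ x * conj (φ (x + t)) ∂(haar D) = inner ℂ (shift t φ) φ := by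
  rw [L2.inner_def]
  refine integral_congr_ae ?_
  filter_upwards [shift_coeFn t φ] with x hx
  rw [hx, RCLike.inner_apply]

theorem sq_norm_eq_integral {α E : Type*} [MeasurableSpace α] {μ : Measure α}
    [NormedAddCommGroup E] (φ : Lp E 2 μ) : ‖φ‖ ^ 2 = ∫ x, ‖φ x‖ ^ 2 ∂μ := by
  have h0 : 0 ≤ ∫ x, ‖φ x‖ ^ 2 ∂μ := integral_nonneg fun _ => sq_nonneg _
  rw [Lp.norm_def, (Lp.memLp φ).eLpNorm_eq_integral_rpow_norm two_ne_zero ENNReal.ofNat_ne_top]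
  simp only [ENNReal.toReal_ofNat, Real.rpow_two]
  rw [ENNReal.toReal_ofReal (Real.rpow_nonneg h0 _), ← Real.rpow_mul_natCast h0]
  norm_num

theorem tendsto_setIntegral_sq_fourierL1 (φ : L2 D) (hφ : Integrable φ (haar D)) :
    Tendsto (fun l : ℤ => ∫ ω in nbhd D' (-l), ‖fourierL1 D' φ ω‖ ^ 2 ∂(haar D')) atTop
      (𝓝 (‖φ‖ ^ 2)) := by
  have hF : Continuous fun t : Vilenkin D => inner ℂ (shift t φ) φ :=
    (continuous_shift φ).inner continuous_const
  have h := tendsto_setAverage_nbhd hF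
  simp only [← integral_mul_conj_eq_inner_shift, ← setIntegral_normSq_fourierL1 (D' := D') hφ,
    Complex.mul_conj, Complex.normSq_eq_norm_sq, integral_complex_ofReal, add_zero,
    ← sq_norm_eq_integral] at h
  exact tendsto_ofReal_iff.mp h

theorem aecover_nbhd_neg (D : DigitSet M) :
    AECover (haar D) atTop fun l : ℤ => (nbhd D (-l) : Set (Vilenkin D)) where
  ae_eventually_mem := .of_forall fun x =>
    tendsto_neg_atTop_atBot.eventually (eventually_mem_nbhd x)
  measurableSet l := measurableSet_nbhd D (-l)

theorem integrableOn_sq_fourierL1 {f : Vilenkin D → ℂ} (hf : Integrable f (haar D)) (l : ℤ) :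
    IntegrableOn (fun ω => ‖fourierL1 D' f ω‖ ^ 2) (nbhd D' l) (haar D') :=
  Integrable.of_bound ((continuous_fourierL1 hf).norm.pow 2).aestronglyMeasurable
    ((∫ x, ‖f x‖ ∂(haar D)) ^ 2) (.of_forall fun ω => by
      rw [norm_pow, norm_norm]
      exact pow_le_pow_left₀ (norm_nonneg _) (norm_fourierL1_le f ω) 2)

theorem memLp_fourierL1 (φ : L2 D) (hφ : Integrable φ (haar D)) :
    MemLp (fourierL1 D' φ) 2 (haar D') :=
  (memLp_two_iff_integrable_sq_norm (continuous_fourierL1 hφ).aestronglyMeasurable).mpr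
    ((aecover_nbhd_neg D').integrable_of_integral_tendsto_of_nonneg_ae _
      (fun _ => integrableOn_sq_fourierL1 hφ _) (.of_forall fun _ => sq_nonneg _)
      (tendsto_setIntegral_sq_fourierL1 φ hφ))

theorem integral_sq_fourierL1 (φ : L2 D) (hφ : Integrable φ (haar D)) :
    ∫ ω, ‖fourierL1 D' φ ω‖ ^ 2 ∂(haar D') = ‖φ‖ ^ 2 :=
  (aecover_nbhd_neg D').integral_eq_of_tendsto_of_nonneg_ae _ (.of_forall fun _ => sq_nonneg _)
    (fun _ => integrableOn_sq_fourierL1 hφ _) (tendsto_setIntegral_sq_fourierL1 φ hφ)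

theorem fourierL1L2_coeFn (f : {f : L2 D // Integrable f (haar D)}) :
    fourierL1L2 D' f =ᵐ[haar D'] fourierL1 D' (f.1 : Vilenkin D → ℂ) := by
  rw [fourierL1L2, dif_pos (memLp_fourierL1 f.1 f.2)]
  exact MemLp.coeFn_toLp _

theorem norm_fourierL1L2 (f : {f : L2 D // Integrable f (haar D)}) :
    ‖fourierL1L2 D' f‖ = ‖f.1‖ := by
  refine (sq_eq_sq₀ (norm_nonneg _) (norm_nonneg _)).mp ?_
  rw [← integral_sq_fourierL1 (D' := D') f.1 f.2, sq_norm_eq_integral]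
  refine integral_congr_ae ?_
  filter_upwards [fourierL1L2_coeFn (D' := D') f] with ω hω
  rw [hω]

end Plancherel

section FourierL2

/-- The subspace `L₁ ∩ L₂` of `L₂`, the domain of `fourierL1L2` as a submodule. -/
def integrableSubmodule (D : DigitSet M) : Submodule ℂ (L2 D) where
  carrier := {f | Integrable f (haar D)}
  zero_mem' := (integrable_zero _ _ _).congr (Lp.coeFn_zero ℂ 2 (haar D)).symm
  add_mem' {f g} hf hg := (Integrable.add hf hg).congr (Lp.coeFn_add f g).symm
  smul_mem' c f hf := (Integrable.smul c hf).congr (Lp.coeFn_smul c f).symm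

theorem fourierL1_congr {f g : Vilenkin D → ℂ} (h : f =ᵐ[haar D] g) :
    fourierL1 D' f = fourierL1 D' g := by
  ext ω
  refine integral_congr_ae ?_
  filter_upwards [h] with x hx
  rw [hx]

theorem fourierL1_add {f g : Vilenkin D → ℂ} (hf : Integrable f (haar D))
    (hg : Integrable g (haar D)) :
    fourierL1 D' (f + g) = fourierL1 D' f + fourierL1 D' g := by
  ext ω
  simp only [fourierL1, Pi.add_apply, add_mul]
  exact integral_add (integrable_mul_conj_chi hf ω) (integrable_mul_conj_chi hg ω)

theorem fourierL1_smul (c : ℂ) (f : Vilenkin D → ℂ) :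
    fourierL1 D' (c • f) = c • fourierL1 D' f := by
  ext ω
  simp only [fourierL1, Pi.smul_apply, smul_eq_mul, mul_assoc, integral_const_mul]

theorem fourierL1_comp_add (f : Vilenkin D → ℂ) (h : Vilenkin D) (ω : Vilenkin D') :
    fourierL1 D' (fun x => f (x + h)) ω = chi h ω * fourierL1 D' f ω := by
  rw [fourierL1, fourierL1, ← integral_const_mul,
    ← integral_add_right_eq_self (fun x => chi h ω * (f x * conj (chi x ω))) h]
  refine integral_congr_ae (.of_forall fun x => ?_)
  have hh : chi h ω * conj (chi h ω) = 1 := by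
    rw [← chi_neg_left, ← chi_add_left, add_neg_cancel, chi_zero_left]
  simp only [chi_add_left, map_mul]
  linear_combination (-f (x + h) * conj (chi x ω)) * hh

/-- The Fourier transform on `L₁ ∩ L₂`, as a linear isometry into `L₂` of the dual group. -/
def fourierIsometry (D : DigitSet M) (D' : DigitSet M.transpose) :
    integrableSubmodule D →ₗᵢ[ℂ] L2 D' where
  toFun f := fourierL1L2 D' ⟨f.1, f.2⟩
  map_add' f g := by
    refine Lp.ext ?_
    filter_upwards [fourierL1L2_coeFn (D' := D') ⟨f.1, f.2⟩,
      fourierL1L2_coeFn (D' := D') ⟨g.1, g.2⟩, fourierL1L2_coeFn (D' := D') ⟨(f + g).1, (f + g).2⟩,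
      Lp.coeFn_add (fourierL1L2 D' ⟨f.1, f.2⟩) (fourierL1L2 D' ⟨g.1, g.2⟩)] with ω hf hg hfg hadd
    rw [hfg, hadd, Pi.add_apply, hf, hg, Submodule.coe_add, fourierL1_congr (Lp.coeFn_add _ _),
      fourierL1_add f.2 g.2, Pi.add_apply]
  map_smul' c f := by
    refine Lp.ext ?_
    filter_upwards [fourierL1L2_coeFn (D' := D') ⟨f.1, f.2⟩,
      fourierL1L2_coeFn (D' := D') ⟨(c • f).1, (c • f).2⟩,
      Lp.coeFn_smul c (fourierL1L2 D' ⟨f.1, f.2⟩)] with ω hf hcf hsmul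
    rw [RingHom.id_apply, hcf, hsmul, Pi.smul_apply, hf, Submodule.coe_smul,
      fourierL1_congr (Lp.coeFn_smul _ _), fourierL1_smul, Pi.smul_apply]
  norm_map' f := norm_fourierL1L2 _

theorem dense_integrableSubmodule (D : DigitSet M) :
    Dense (integrableSubmodule D : Set (L2 D)) := by
  refine (Lp.simpleFunc.dense (E := ℂ) (p := 2) (μ := haar D) ENNReal.ofNat_ne_top).mono ?_
  intro f hf
  have hs := (Lp.simpleFunc.memLp (⟨f, hf⟩ : Lp.simpleFunc ℂ 2 (haar D)))
  refine ((SimpleFunc.memLp_iff_integrable two_ne_zero ENNReal.ofNat_ne_top).mp hs).congr ?_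
  exact Lp.simpleFunc.toSimpleFunc_eq_toFun (⟨f, hf⟩ : Lp.simpleFunc ℂ 2 (haar D))

/-- The Fourier transform on `L₂` as a continuous linear map, obtained by extending
`fourierIsometry`. -/
def fourierCLM (D : DigitSet M) (D' : DigitSet M.transpose) : L2 D →L[ℂ] L2 D' :=
  (fourierIsometry D D').toContinuousLinearMap.extend (integrableSubmodule D).subtypeL

theorem fourierCLM_coe (f : integrableSubmodule D) :
    fourierCLM D D' f = fourierIsometry D D' f :=
  ContinuousLinearMap.extend_eq (fourierIsometry D D').toContinuousLinearMap
    (dense_integrableSubmodule D).denseRange_val isUniformEmbedding_subtype_val.isUniformInducing f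

theorem fourierL2_eq_fourierCLM (φ : L2 D) : fourierL2 D' φ = fourierCLM D D' φ := by
  have hne : (comap (Subtype.val : {f : L2 D // Integrable f (haar D)} → L2 D) (𝓝 φ)).NeBot :=
    mem_closure_iff_comap_neBot.mp (dense_integrableSubmodule D φ)
  refine Tendsto.limUnder_eq ?_
  refine (((fourierCLM D D').continuous.tendsto φ).comp tendsto_comap).congr fun f => ?_
  exact fourierCLM_coe ⟨f.1, f.2⟩

theorem norm_fourierCLM (φ : L2 D) : ‖fourierCLM D D' φ‖ = ‖φ‖ := by
  refine congrFun ((dense_integrableSubmodule D).denseRange_val.equalizer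
    (fourierCLM D D').continuous.norm continuous_norm (funext fun f => ?_)) φ
  exact (congrArg norm (fourierCLM_coe f)).trans ((fourierIsometry D D').norm_map f)

theorem inner_fourierL2 (φ ψ : L2 D) :
    inner ℂ (fourierL2 D' φ) (fourierL2 D' ψ) = inner ℂ φ ψ := by
  rw [fourierL2_eq_fourierCLM, fourierL2_eq_fourierCLM]
  exact LinearIsometry.inner_map_map ⟨(fourierCLM D D').toLinearMap, norm_fourierCLM⟩ φ ψ

end FourierL2

section Shifts

theorem memLp_chi_mul (h : Vilenkin D) (g : L2 D') :
    MemLp (fun ω => chi h ω * g ω) 2 (haar D') := by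
  refine (Lp.memLp g).of_le
    ((continuous_chi_right h).aestronglyMeasurable.mul (Lp.aestronglyMeasurable g))
    (.of_forall fun ω => ?_)
  rw [norm_mul, norm_chi, one_mul]

/-- Multiplication by the character `χ(h, ·)` on `L₂`, the Fourier-side counterpart of `shift h`. -/
def mulChi (h : Vilenkin D) (g : L2 D') : L2 D' := (memLp_chi_mul h g).toLp _

theorem mulChi_coeFn (h : Vilenkin D) (g : L2 D') :
    mulChi h g =ᵐ[haar D'] fun ω => chi h ω * g ω := MemLp.coeFn_toLp _

theorem isometry_mulChi (h : Vilenkin D) : Isometry (mulChi (D' := D') h) := by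
  intro g g'
  rw [Lp.edist_def, Lp.edist_def]
  refine eLpNorm_congr_norm_ae ?_
  filter_upwards [mulChi_coeFn h g, mulChi_coeFn h g'] with ω hg hg'
  rw [Pi.sub_apply, hg, hg', ← mul_sub, norm_mul, norm_chi, one_mul, Pi.sub_apply]

theorem isometry_shift (h : Vilenkin D) : Isometry (shift (D := D) h) :=
  Lp.isometry_compMeasurePreserving (measurePreserving_add_right (haar D) h)

theorem shift_mem_integrableSubmodule (h : Vilenkin D) {f : L2 D}
    (hf : f ∈ integrableSubmodule D) : shift h f ∈ integrableSubmodule D :=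
  (Integrable.comp_add_right (f := (f : Vilenkin D → ℂ)) hf h).congr (shift_coeFn h f).symm

theorem fourierL1L2_shift (h : Vilenkin D) (f : integrableSubmodule D) :
    fourierL1L2 D' ⟨shift h f.1, shift_mem_integrableSubmodule h f.2⟩ =
      mulChi h (fourierL1L2 D' ⟨f.1, f.2⟩) := by
  refine Lp.ext ?_
  filter_upwards [fourierL1L2_coeFn (D' := D') ⟨_, shift_mem_integrableSubmodule h f.2⟩,
    fourierL1L2_coeFn (D' := D') ⟨f.1, f.2⟩, mulChi_coeFn h (fourierL1L2 D' ⟨f.1, f.2⟩)]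
    with ω hshift hf hmul
  rw [hshift, hmul, hf, fourierL1_congr (shift_coeFn h f.1), fourierL1_comp_add]

theorem fourierL2_shift (h : Vilenkin D) (φ : L2 D) :
    fourierL2 D' (shift h φ) = mulChi h (fourierL2 D' φ) := by
  rw [fourierL2_eq_fourierCLM, fourierL2_eq_fourierCLM]
  refine congrFun ((dense_integrableSubmodule D).denseRange_val.equalizer
    ((fourierCLM D D').continuous.comp (isometry_shift h).continuous)
    ((isometry_mulChi h).continuous.comp (fourierCLM D D').continuous) (funext fun f => ?_)) φ
  simp only [Function.comp_apply]
  rw [fourierCLM_coe, fourierCLM_coe ⟨_, shift_mem_integrableSubmodule h f.2⟩]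
  exact fourierL1L2_shift h f

theorem inner_shift_eq_integral (D' : DigitSet M.transpose) (h : Vilenkin D) (φ : L2 D) :
    inner ℂ φ (shift h φ) =
      ∫ ω, chi h ω * ((‖fourierL2 D' φ ω‖ ^ 2 : ℝ) : ℂ) ∂(haar D') := by
  rw [← inner_fourierL2 (D' := D'), fourierL2_shift, L2.inner_def]
  refine integral_congr_ae ?_
  filter_upwards [mulChi_coeFn h (fourierL2 D' φ)] with ω hω
  rw [hω, RCLike.inner_apply, mul_assoc, Complex.mul_conj, Complex.normSq_eq_norm_sq]

open Classical in
theorem orthonormal_shift_iff (φ : L2 D) :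
    Orthonormal ℂ (fun h : subgroupH D => shift (h : Vilenkin D) φ) ↔
      ∀ h ∈ subgroupH D, inner ℂ φ (shift h φ) = if h = 0 then (1 : ℂ) else 0 := by
  have key (h k : Vilenkin D) : inner ℂ (shift h φ) (shift k φ) = inner ℂ φ (shift (k - h) φ) := by
    rw [← inner_shift_shift h φ (shift (k - h) φ), ← shift_add, add_sub_cancel]
  simp only [orthonormal_iff_ite, key]
  constructor
  · intro H h hh
    simpa [eq_comm, Subtype.ext_iff] using H 0 ⟨h, hh⟩
  · intro H h k
    rw [H _ (sub_mem k.2 h.2)]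
    simp only [sub_eq_zero, Subtype.ext_iff, eq_comm (a := (k : Vilenkin D))]

end Shifts

section Uniqueness

theorem setIntegral_chi_left (ω : Vilenkin D') (l : ℤ) :
    ∫ x in nbhd D (-l), chi x ω ∂(haar D) =
      (nbhd D' l : Set (Vilenkin D')).indicator
        (fun _ => (((haar D').real (nbhd D' l))⁻¹ : ℂ)) ω :=
  (integral_congr_ae (.of_forall fun x => (chi_transpose x ω).symm)).trans
    (setIntegral_chi (D' := D) ω l)

theorem measureReal_coset_eq_setIntegral (D : DigitSet M) (ν : Measure (Vilenkin D'))
    [IsFiniteMeasure ν] (a : Vilenkin D') (k : ℤ) :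
    (ν.real (coset a k) : ℂ) = (haar D').real (nbhd D' k) *
      ∫ x in nbhd D (-k), chi x (-a) * ∫ ω, chi x ω ∂ν ∂(haar D) := by
  have hint : Integrable (Function.uncurry fun (x : Vilenkin D) ω => chi x (-a + ω))
      (((haar D).restrict (nbhd D (-k))).prod ν) := by
    refine Integrable.of_bound (C := 1) ?_ (.of_forall fun p => (norm_chi _ _).le)
    exact (Continuous.comp (f := fun p : Vilenkin D × Vilenkin D' => (p.1, -a + p.2))
      (continuous_chi (D := D) (D' := D')) (by fun_prop)).aestronglyMeasurable
  have hne : ((haar D').real (nbhd D' k) : ℂ) ≠ 0 :=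
    Complex.ofReal_ne_zero.mpr (measureReal_nbhd_ne_zero D' k)
  have hind (ω : Vilenkin D') : ∫ x in nbhd D (-k), chi x (-a + ω) ∂(haar D) =
      (coset a k).indicator (fun _ => (((haar D').real (nbhd D' k))⁻¹ : ℂ)) ω := by
    rw [setIntegral_chi_left, neg_add_eq_sub]
    rfl
  have hswap : ∫ x in nbhd D (-k), chi x (-a) * ∫ ω, chi x ω ∂ν ∂(haar D) =
      ∫ ω, ∫ x in nbhd D (-k), chi x (-a + ω) ∂(haar D) ∂ν := by
    simp only [← integral_const_mul, ← chi_add_right]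
    exact integral_integral_swap hint
  rw [hswap]
  simp only [hind]
  rw [integral_indicator (isOpen_coset a k).measurableSet, setIntegral_const, Complex.real_smul,
    mul_left_comm, mul_inv_cancel₀ hne, mul_one]

theorem measure_ext_of_integral_chi (D : DigitSet M) {ν ρ : Measure (Vilenkin D')}
    [IsFiniteMeasure ν] [IsFiniteMeasure ρ]
    (h : ∀ x : Vilenkin D, ∫ ω, chi x ω ∂ν = ∫ ω, chi x ω ∂ρ) : ν = ρ := by
  refine ext_of_generate_finite _
    ((instBorelSpaceVilenkin D').measurable_eq.trans
      (isTopologicalBasis_coset D').borel_eq_generateFrom) (isPiSystem_range_coset D') ?_ ?_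
  · rintro _ ⟨⟨a, k⟩, rfl⟩
    refine (measureReal_eq_measureReal_iff).mp (Complex.ofReal_injective ?_)
    simp only [measureReal_coset_eq_setIntegral D, h]
  · have h0 := h 0
    simp only [chi_zero_left, integral_const, Complex.real_smul, mul_one] at h0
    exact (measureReal_eq_measureReal_iff).mp (Complex.ofReal_injective h0)

theorem measure_ext_of_integral_chi_subgroupH (D : DigitSet M) {ν ρ : Measure (Vilenkin D')}
    [IsFiniteMeasure ν] [IsFiniteMeasure ρ]
    (hν : ∀ᵐ ω ∂ν, ω ∈ nbhd D' 0) (hρ : ∀ᵐ ω ∂ρ, ω ∈ nbhd D' 0)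
    (h : ∀ x ∈ subgroupH D, ∫ ω, chi x ω ∂ν = ∫ ω, chi x ω ∂ρ) : ν = ρ := by
  have htrunc (x : Vilenkin D) {τ : Measure (Vilenkin D')} (hτ : ∀ᵐ ω ∂τ, ω ∈ nbhd D' 0) :
      ∫ ω, chi x ω ∂τ = ∫ ω, chi (trunc 0 x) ω ∂τ := by
    refine integral_congr_ae ?_
    filter_upwards [hτ] with ω hω
    exact chi_eq_of_mem_coset_left (add_zero 0).ge (sub_trunc_mem_nbhd 0 x) hω
  refine measure_ext_of_integral_chi D fun x => ?_
  rw [htrunc x hν, htrunc x hρ, h _ (trunc_zero_mem_subgroupH x)]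

end Uniqueness

section Periodization

variable {G : Type*} [AddCommGroup G]

/-- The periodization `x ↦ ∑_{h ∈ H} F (x + h)` of a function along a subgroup `H`,
with values in `ℝ≥0∞` so that the sum always makes sense. -/
def periodization (H : AddSubgroup G) (F : G → ℝ≥0∞) (x : G) : ℝ≥0∞ :=
  ∑' h : H, F (x + h)

theorem periodization_vadd {H : AddSubgroup G} (F : G → ℝ≥0∞) (h : H) (x : G) :
    periodization H F (h +ᵥ x) = periodization H F x := by
  refine ((Equiv.addLeft h).tsum_eq fun k : H => F (x + k)).symm.trans ?_ |>.symm
  refine tsum_congr fun k => ?_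
  rw [Equiv.coe_addLeft, AddSubgroup.coe_add, AddSubgroup.vadd_def, vadd_eq_add, add_left_comm,
    ← add_assoc]

variable [MeasurableSpace G] [MeasurableAdd G] {μ : Measure G} {H : AddSubgroup G} [Countable H]
  {s : Set G}

theorem measurable_periodization {F : G → ℝ≥0∞} (hF : Measurable F) :
    Measurable (periodization H F) :=
  Measurable.tsum fun h => hF.comp (measurable_add_const (h : G))

theorem withDensity_periodization {F : G → ℝ≥0∞} (hF : Measurable F) (ν : Measure G) :
    ν.withDensity (periodization H F) = .sum fun h : H => ν.withDensity fun x => F (x + h) := by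
  rw [← withDensity_tsum (f := fun (h : H) x => F (x + h)) fun h =>
    hF.comp (measurable_add_const (h : G))]
  congr 1
  ext x
  exact (ENNReal.tsum_apply (f := fun (h : H) x => F (x + h))).symm

variable [μ.IsAddLeftInvariant]

theorem lintegral_withDensity_periodization (hs : IsAddFundamentalDomain H s μ)
    {F g : G → ℝ≥0∞} (hF : Measurable F) (hg : Measurable g) (hgH : ∀ (h : H) x, g (x + h) = g x) :
    ∫⁻ x, g x ∂(μ.restrict s).withDensity (periodization H F) = ∫⁻ x, g x ∂μ.withDensity F := by
  rw [withDensity_periodization hF, lintegral_sum_measure,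
    lintegral_withDensity_eq_lintegral_mul _ hF hg, hs.lintegral_eq_tsum'']
  refine tsum_congr fun h => ?_
  rw [lintegral_withDensity_eq_lintegral_mul (f := fun x => F (x + h)) _
    (hF.comp (measurable_add_const (h : G))) hg]
  refine lintegral_congr fun x => ?_
  simp only [Pi.mul_apply, AddSubgroup.vadd_def, vadd_eq_add, add_comm (h : G), hgH]

theorem integral_withDensity_periodization {E : Type*} [NormedAddCommGroup E] [NormedSpace ℝ E]
    (hs : IsAddFundamentalDomain H s μ) {F : G → NNReal} (hF : Measurable F) {g : G → E}
    (hg : StronglyMeasurable g) (hgH : ∀ (h : H) x, g (x + h) = g x)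
    (hint : Integrable g (μ.withDensity fun x => F x)) :
    ∫ x, g x ∂(μ.restrict s).withDensity (periodization H fun x => F x) =
      ∫ x, g x ∂μ.withDensity fun x => F x := by
  have hsum : Integrable g ((μ.restrict s).withDensity (periodization H fun x => F x)) := by
    refine ⟨hg.aestronglyMeasurable, ?_⟩
    rw [HasFiniteIntegral, lintegral_withDensity_periodization hs hF.coe_nnreal_ennreal hg.enorm
      fun h x => by rw [hgH]]
    exact hint.2
  rw [withDensity_periodization hF.coe_nnreal_ennreal] at hsum ⊢
  rw [integral_sum_measure hsum, integral_withDensity_eq_integral_smul hF,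
    hs.integral_eq_tsum'' _ ((integrable_withDensity_iff_integrable_smul hF).mp hint)]
  refine tsum_congr fun h => ?_
  rw [integral_withDensity_eq_integral_smul (f := fun x => F (x + h))
    (hF.comp (measurable_add_const (h : G)))]
  refine integral_congr_ae (.of_forall fun x => ?_)
  simp only [AddSubgroup.vadd_def, vadd_eq_add, add_comm (h : G), hgH]

theorem ae_periodization_eq_iff (hs : IsAddFundamentalDomain H s μ) (F : G → ℝ≥0∞) (c : ℝ≥0∞) :
    (∀ᵐ x ∂μ, periodization H F x = c) ↔ ∀ᵐ x ∂μ.restrict s, periodization H F x = c := by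
  refine ⟨fun h => ae_restrict_of_ae h, fun h => ?_⟩
  refine hs.measure_zero_of_invariant _ (fun k => ?_) ?_
  · ext x
    simp [Set.mem_vadd_set_iff_neg_vadd_mem, periodization_vadd]
  · rwa [← Measure.restrict_apply₀' hs.nullMeasurableSet]

theorem withDensity_periodization_eq_restrict_iff [SigmaFinite μ]
    (hs : IsAddFundamentalDomain H s μ) {F : G → ℝ≥0∞} (hF : Measurable F) :
    (μ.restrict s).withDensity (periodization H F) = μ.restrict s ↔
      ∀ᵐ x ∂μ, periodization H F x = 1 := by
  rw [ae_periodization_eq_iff hs]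
  conv_lhs => rhs; rw [← withDensity_one (μ := μ.restrict s)]
  exact withDensity_eq_iff_of_sigmaFinite (measurable_periodization hF).aemeasurable
    aemeasurable_one

end Periodization

section Bracket

theorem isAddFundamentalDomain_subgroupH_nbhd_zero (D : DigitSet M) :
    IsAddFundamentalDomain (subgroupH D) (nbhd D 0 : Set (Vilenkin D)) (haar D) := by
  have hmem (x : Vilenkin D) : -trunc 0 x + x ∈ nbhd D 0 := by
    rw [neg_add_eq_sub]
    exact sub_trunc_mem_nbhd 0 x
  refine .mk' (measurableSet_nbhd D 0).nullMeasurableSet fun x =>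
    ⟨⟨-trunc 0 x, neg_mem (trunc_zero_mem_subgroupH x)⟩, hmem x, fun h hh => Subtype.ext ?_⟩
  refine sub_eq_zero.mp (AddSubgroup.disjoint_def.mp (disjoint_subgroupH_nbhd_zero D) ?_ ?_)
  · exact sub_mem h.2 (neg_mem (trunc_zero_mem_subgroupH x))
  · rw [← add_sub_add_right_eq_sub _ _ x]
    exact sub_mem hh (hmem x)

open Classical in
theorem setIntegral_nbhd_zero_chi (D' : DigitSet M.transpose) {h : Vilenkin D}
    (hh : h ∈ subgroupH D) :
    ∫ ω in nbhd D' 0, chi h ω ∂(haar D') = if h = 0 then 1 else 0 := by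
  have hmem : h ∈ nbhd D 0 ↔ h = 0 :=
    ⟨AddSubgroup.disjoint_def.mp (disjoint_subgroupH_nbhd_zero D) hh, fun h0 => h0 ▸ zero_mem _⟩
  have := setIntegral_chi (D' := D') h 0
  rw [neg_zero] at this
  rw [this, Set.indicator_apply, Measure.real, haar_nbhd, neg_zero, zpow_zero, ENNReal.toReal_one,
    Complex.ofReal_one, inv_one]
  exact if_congr hmem rfl rfl

open Classical in
theorem integral_chi_withDensity_eq_ite_iff (D : DigitSet M) {F : Vilenkin D' → NNReal}
    (hF : Measurable F) (hfin : ∫⁻ ω, F ω ∂(haar D') ≠ ⊤) :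
    (∀ h ∈ subgroupH D, ∫ ω, chi h ω ∂(haar D').withDensity (fun ω => F ω) =
        if h = 0 then 1 else 0) ↔
      ∀ᵐ ω ∂(haar D'), periodization (subgroupH D') (fun ω => F ω) ω = 1 := by
  have hs := isAddFundamentalDomain_subgroupH_nbhd_zero D'
  set ν := (haar D').withDensity fun ω => (F ω : ℝ≥0∞)
  set ρ := (haar D').restrict (nbhd D' 0)
  set P := periodization (subgroupH D') fun ω => (F ω : ℝ≥0∞)
  have : IsFiniteMeasure ν := isFiniteMeasure_withDensity hfin
  have hfold (h : Vilenkin D) (hh : h ∈ subgroupH D) :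
      ∫ ω, chi h ω ∂ρ.withDensity P = ∫ ω, chi h ω ∂ν := by
    refine integral_withDensity_periodization hs hF
      (continuous_chi_right h).stronglyMeasurable (fun k ω => ?_) (integrable_chi_right h ν)
    rw [chi_add_right, chi_eq_one_of_mem_subgroupH hh k.2, mul_one]
  rw [← withDensity_periodization_eq_restrict_iff hs hF.coe_nnreal_ennreal]
  constructor
  · intro hν
    have : IsFiniteMeasure (ρ.withDensity P) := by
      refine ⟨?_⟩
      rw [← lintegral_one]
      refine (lintegral_withDensity_periodization hs hF.coe_nnreal_ennreal measurable_one
        fun _ _ => rfl).trans_lt ?_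
      exact lintegral_one.trans_lt (measure_lt_top ν _)
    have : IsFiniteMeasure ρ := instIsFiniteMeasureRestrictNbhd D' 0
    have hρ : ∀ᵐ ω ∂ρ, ω ∈ nbhd D' 0 := ae_restrict_mem (measurableSet_nbhd D' 0)
    refine measure_ext_of_integral_chi_subgroupH D (withDensity_absolutelyContinuous _ _ hρ) hρ
      fun h hh => ?_
    rw [hfold h hh, hν h hh, setIntegral_nbhd_zero_chi D' hh]
  · intro hρ h hh
    rw [← hfold h hh, hρ, setIntegral_nbhd_zero_chi D' hh]

theorem lintegral_sq_nnnorm_lt_top {α E : Type*} [MeasurableSpace α] {μ : Measure α}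
    [NormedAddCommGroup E] {f : α → E} (hf : MemLp f 2 μ) :
    ∫⁻ x, (‖f x‖₊ ^ 2 : NNReal) ∂μ < ⊤ := by
  refine (lintegral_congr fun x => ?_).trans_lt (hf.integrable_norm_pow two_ne_zero).2
  rw [enorm_pow, enorm_norm, ENNReal.coe_pow, enorm_eq_nnnorm]

theorem inner_shift_eq_integral_withDensity (D' : DigitSet M.transpose) (h : Vilenkin D)
    (φ : L2 D) :
    inner ℂ φ (shift h φ) =
      ∫ ω, chi h ω ∂(haar D').withDensity fun ω => (‖fourierL2 D' φ ω‖₊ ^ 2 : NNReal) := by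
  rw [inner_shift_eq_integral D', integral_withDensity_eq_integral_smul
    ((Lp.stronglyMeasurable _).nnnorm.measurable.pow_const 2)]
  refine integral_congr_ae (.of_forall fun ω => ?_)
  simp only [NNReal.smul_def, NNReal.coe_pow, coe_nnnorm, Complex.real_smul, mul_comm]

theorem hasSum_sq_norm_iff {ι E : Type*} [SeminormedAddCommGroup E] (g : ι → E) :
    HasSum (fun i => ‖g i‖ ^ 2) 1 ↔ ∑' i, ((‖g i‖₊ ^ 2 : NNReal) : ℝ≥0∞) = 1 := by
  rw [← ENNReal.summable.hasSum_iff, ← ENNReal.coe_one, ENNReal.hasSum_coe, ← NNReal.hasSum_coe]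
  simp only [NNReal.coe_pow, coe_nnnorm, NNReal.coe_one]

end Bracket

end GenVilenkin

end

theorem theorem4_general {d : ℕ} (M : Matrix (Fin d) (Fin d) ℤ)
    (D : GenVilenkin.DigitSet M) (D' : GenVilenkin.DigitSet M.transpose)
    (φ : GenVilenkin.L2 D) :
    Orthonormal ℂ (fun h : GenVilenkin.subgroupH D =>
      GenVilenkin.shift (h : GenVilenkin.Vilenkin D) φ) ↔
      ∀ᵐ ω ∂(GenVilenkin.haar D'),
        HasSum (fun h' : GenVilenkin.subgroupH D' =>
          ‖GenVilenkin.fourierL2 D' φ (ω + (h' : GenVilenkin.Vilenkin D'))‖ ^ 2) 1 := by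
  classical
  have hmeas : Measurable fun ω => ‖GenVilenkin.fourierL2 D' φ ω‖₊ ^ 2 :=
    (Lp.stronglyMeasurable _).nnnorm.measurable.pow_const 2
  have hfin := GenVilenkin.lintegral_sq_nnnorm_lt_top (Lp.memLp (GenVilenkin.fourierL2 D' φ))
  simp only [GenVilenkin.orthonormal_shift_iff, GenVilenkin.hasSum_sq_norm_iff,
    GenVilenkin.inner_shift_eq_integral_withDensity D']
  exact GenVilenkin.integral_chi_withDensity_eq_ite_iff D hmeas hfin.ne

theorem theorem4 {d : ℕ} (M : Matrix (Fin d) (Fin d) ℤ) (hM : GenVilenkin.IsDilationMatrix M)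
    (D : GenVilenkin.DigitSet M) (D' : GenVilenkin.DigitSet M.transpose)
    (φ : GenVilenkin.L2 D) :
    Orthonormal ℂ (fun h : GenVilenkin.subgroupH D =>
      GenVilenkin.shift (h : GenVilenkin.Vilenkin D) φ) ↔
      ∀ᵐ ω ∂(GenVilenkin.haar D'),
        HasSum (fun h' : GenVilenkin.subgroupH D' =>
          ‖GenVilenkin.fourierL2 D' φ (ω + (h' : GenVilenkin.Vilenkin D'))‖ ^ 2) 1 :=
  theorem4_general M D D' φ
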